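/- **Setting.** Let $\mathcal D,\mathcal D'$ be sets of probability measures on $\mathbb R$, those in $\mathcal D$ having finite mean. Let there be $K$ arms, functions $d_k:\mathcal P(\mathbb R)^2\to[0,\infty]$, radii $L_k\in[0,\infty]$ and sample sizes $N'_k=N'_k(T)\in\mathbb N\cup\{\infty\}$, which may depend on the horizon $T$. An *instance* is a pair $(\nu,\nu')\in\mathcal D^K\times\mathcal D'^K$ with $d_i(\nu_i,\nu'_i)\le L_i$ for all arms $i$. For horizon $T$ the learner first receives independent samples, $N'_i(T)$ of them from $\nu'_i$ for each $i$. In each of the rounds $1,\dots,T$ it then pulls an arm (possibly at random, depending on the offline data and on past pulls and rewards) and receives a reward drawn from the law $\nu_i$ of the pulled arm $i$. $N_k(T)$ is the number of pulls of arm $k$ in the $T$ rounds. The algorithm may depend on $T$. Write $\mu_i=\mathbb E[\nu_i]$; arm $k$ is suboptimal if $\mu_k<\max_i\mu_i$. The algorithm is *consistent* if for every instance, every suboptimal arm $k$ and every $\alpha>0$, $\mathbb E[N_k(T)]=o(T^\alpha)$ as $T\to\infty$. Use the convention $0\cdot\infty=0$ and $\inf\emptyset=\infty$. **Theorem.** Let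 the algorithm be consistent, let $(\nu,\nu')$ be an instance in which arm $1$ has the highest mean, and let $k$ be a suboptimal arm. Let $\mathcal A$ be the set of pairs $(\tilde\nu_k,\tilde\nu'_k)\in\mathcal D\times\mathcal D'$ with $\mathbb E[\tilde\nu_k]>\mu_1$ and $d_k(\tilde\nu_k,\tilde\nu'_k)\le L_k$. 1. For every $(\tilde\nu_k,\tilde\nu'_k)\in\mathcal A$, $$\liminf_{T\to\infty}\frac{\mathbb E[N_k(T)]\,\mathrm{KL}(\nu_k,\tilde\nu_k)+N'_k\,\mathrm{KL}(\nu'_k,\tilde\nu'_k)}{\ln T}\ge 1 .$$ 2. Suppose that $\inf_{\mathcal A}\mathrm{KL}(\nu_k,\tilde\nu_k)>0$ and that at least one of the following holds: (a) there is a finite $C$ such that for all large $T$, $N'_k(T)=\infty$ or $N'_k(T)\le C\ln T$ (for instance, $N'_k$ does not depend on $T$); (b) $\mathbb E[N_j(T)]=o(T^\alpha)$ holds for all $\alpha>0$ and all suboptimal arms $j$ at every pair in $\mathcal D^K\times\mathcal D'^K$, whether or not it satisfies $d_i\le L_i$; (c) with $x_0=\inf\{\mathrm{KL}(\nu_k,\tilde\nu_k):(\tilde\nu_k,\nu'_k)\in\mathcal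 A\}$: for every $c<x_0$ (and also for $c=\infty$ if $x_0=\infty$) there is $\eta>0$ such that $\mathrm{KL}(\nu'_k,\tilde\nu'_k)\ge\eta$ for all $(\tilde\nu_k,\tilde\nu'_k)\in\mathcal A$ with $\mathrm{KL}(\nu_k,\tilde\nu_k)\le c$. Then $$\liminf_{T\to\infty}\ \inf_{(\tilde\nu_k,\tilde\nu'_k)\in\mathcal A}\frac{\mathbb E[N_k(T)]\,\mathrm{KL}(\nu_k,\tilde\nu_k)+N'_k\,\mathrm{KL}(\nu'_k,\tilde\nu'_k)}{\ln T}\ge 1 .$$ 3. Let $\mathcal K_{\inf}(\nu'_k;d_k,\tilde\nu_k,L_k)=\inf\{\mathrm{KL}(\nu'_k,\tilde\nu'_k):\tilde\nu'_k\in\mathcal D',\,d_k(\tilde\nu_k,\tilde\nu'_k)\le L_k\}$. In the situation of 2, suppose also that $N'_k(T)<\infty$ for all $T$, or that every $\tilde\nu_k$ occurring in $\mathcal A$ with $\mathcal K_{\inf}(\nu'_k;d_k,\tilde\nu_k,L_k)=0$ satisfies $d_k(\tilde\nu_k,\nu'_k)\le L_k$. Then for every $T\ge2$ the infimum in 2 equals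 $$\inf_{\tilde\nu_k}\frac{\mathbb E[N_k(T)]\,\mathrm{KL}(\nu_k,\tilde\nu_k)+N'_k\,\mathcal K_{\inf}(\nu'_k;d_k,\tilde\nu_k,L_k)}{\ln T},$$ the infimum running over the $\tilde\nu_k$ that occur in $\mathcal A$, and so the $\liminf$ of this expression is at least $1$. -/

import Mathlib

open MeasureTheory ProbabilityTheory InformationTheory Filter Topology Asymptotics
open scoped ENNReal NNReal

namespace TransferBandit

/-- Offline data: for each arm `i`, a finite or infinite sequence of `n i` real samples. -/
abbrev OfflineData {K : ℕ} (n : Fin K → ℕ∞) : Type :=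
  (i : Fin K) → {j : ℕ // (j : ℕ∞) < n i} → ℝ

/-- The first `t` rounds of play: the arm pulled and the reward received in each round. -/
abbrev History (K t : ℕ) : Type := Fin t → Fin K × ℝ

/-- A (randomized) policy: in round `t` (rounds are counted from `0`), the law of the next arm given
the offline data and the first `t` rounds. -/
structure Policy {K : ℕ} (n : Fin K → ℕ∞) where
  select : (t : ℕ) → Kernel (OfflineData n × History K t) (Fin K)
  isMarkov : ∀ t, IsMarkovKernel (select t)

/-- An algorithm: for each horizon `T`, a policy that uses the offline samples available at this
horizon. (If the sample sizes do not depend on `T`, this includes the algorithms that play the same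
policy at every horizon.) -/
abbrev Algorithm {K : ℕ} (N' : ℕ → Fin K → ℕ∞) : Type := (T : ℕ) → Policy (N' T)

/-- Law of the offline data: all samples are independent, those of arm `i` have law `ν' i`. -/
noncomputable def offlineLaw {K : ℕ} (n : Fin K → ℕ∞) (ν' : Fin K → ProbabilityMeasure ℝ) :
    Measure (OfflineData n) :=
  Measure.pi fun i => Measure.infinitePi fun _ : {j : ℕ // (j : ℕ∞) < n i} => (ν' i : Measure ℝ)

/-- Given the arm that is pulled, the law of the reward. -/
noncomputable def rewardKernel {K : ℕ} (ν : Fin K → ProbabilityMeasure ℝ) : Kernel (Fin K) ℝ :=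
  Kernel.ofFunOfCountable fun i => (ν i : Measure ℝ)

instance {K : ℕ} (ν : Fin K → ProbabilityMeasure ℝ) : IsMarkovKernel (rewardKernel ν) :=
  ⟨fun i => inferInstanceAs (IsProbabilityMeasure (ν i : Measure ℝ))⟩

/-- Joint law of the offline data and of the first `t` rounds when `π` is played on the target
bandit `ν` with source `ν'`. -/
noncomputable def law {K : ℕ} {n : Fin K → ℕ∞} (π : Policy n)
    (ν ν' : Fin K → ProbabilityMeasure ℝ) : (t : ℕ) → Measure (OfflineData n × History K t)
  | 0 => (offlineLaw n ν').map fun x => (x, Fin.elim0)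
  | t + 1 =>
      ((law π ν ν' t) ⊗ₘ
        ((π.select t) ⊗ₖ
          (Kernel.prodMkLeft (OfflineData n × History K t) (rewardKernel ν)))).map
        fun p => (p.1.1, Fin.snoc (α := fun _ => Fin K × ℝ) p.1.2 p.2)

/-- The map that appends a round to the history is measurable, so that `law` is not a junk value. -/
theorem measurable_append {K : ℕ} (n : Fin K → ℕ∞) (t : ℕ) :
    Measurable fun p : (OfflineData n × History K t) × (Fin K × ℝ) =>
      ((p.1.1, Fin.snoc (α := fun _ => Fin K × ℝ) p.1.2 p.2) :
        OfflineData n × History K (t + 1)) := by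
  refine Measurable.prodMk (by fun_prop) (measurable_pi_iff.2 fun i => ?_)
  refine Fin.lastCases ?_ (fun j => ?_) i
  · simpa using measurable_snd
  · simp only [Fin.snoc_castSucc]
    fun_prop

theorem isProbabilityMeasure_law {K : ℕ} {n : Fin K → ℕ∞} (π : Policy n)
    (ν ν' : Fin K → ProbabilityMeasure ℝ) (t : ℕ) : IsProbabilityMeasure (law π ν ν' t) := by
  induction t with
  | zero =>
    have : IsProbabilityMeasure (offlineLaw n ν') := by unfold offlineLaw; infer_instance
    exact Measure.isProbabilityMeasure_map (by fun_prop)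
  | succ t ih =>
    have := π.isMarkov t
    exact Measure.isProbabilityMeasure_map (measurable_append n t).aemeasurable

/-- `E[N_k(T)]`: the expected number of pulls of arm `k` in the first `T` rounds. -/
noncomputable def expectedPulls {K : ℕ} {n : Fin K → ℕ∞} (π : Policy n)
    (ν ν' : Fin K → ProbabilityMeasure ℝ) (k : Fin K) (T : ℕ) : ℝ≥0∞ :=
  ∫⁻ h, ((Finset.univ.filter fun t : Fin T => (h.2 t).1 = k).card : ℝ≥0∞) ∂(law π ν ν' T)

/-- The mean of a law on the real line. -/
noncomputable def mean (ρ : ProbabilityMeasure ℝ) : ℝ := ∫ x, x ∂(ρ : Measure ℝ)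

/-- Kullback-Leibler divergence of two laws. -/
noncomputable def KL (ρ σ : ProbabilityMeasure ℝ) : ℝ≥0∞ :=
  klDiv (ρ : Measure ℝ) (σ : Measure ℝ)

/-- The parameters `(𝒟, 𝒟', d, L, N')` of a transfer problem with `K` arms. The sample sizes may
depend on the horizon and may be infinite. -/
structure Setting (K : ℕ) where
  𝒟 : Set (ProbabilityMeasure ℝ)
  𝒟' : Set (ProbabilityMeasure ℝ)
  d : Fin K → ProbabilityMeasure ℝ → ProbabilityMeasure ℝ → ℝ≥0∞
  L : Fin K → ℝ≥0∞
  N' : ℕ → Fin K → ℕ∞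

variable {K : ℕ}

/-- The target `ν` and the source `ν'` form an instance of the transfer setting: they belong to
the classes and each source arm is related to its target arm. -/
def Setting.IsInstance (S : Setting K) (ν ν' : Fin K → ProbabilityMeasure ℝ) : Prop :=
  (∀ i, ν i ∈ S.𝒟) ∧ (∀ i, ν' i ∈ S.𝒟') ∧ ∀ i, S.d i (ν i) (ν' i) ≤ S.L i

/-- Arm `k` is suboptimal for the target `ν`. -/
def Suboptimal (ν : Fin K → ProbabilityMeasure ℝ) (k : Fin K) : Prop :=
  ∃ j, mean (ν k) < mean (ν j)

/-- For every suboptimal arm `k` and every `α > 0`, `E[N_k(T)] = o(T ^ α)`. -/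
def SubpolynomialPulls {N' : ℕ → Fin K → ℕ∞} (A : Algorithm N')
    (ν ν' : Fin K → ProbabilityMeasure ℝ) : Prop :=
  ∀ k, Suboptimal ν k → ∀ α : ℝ, 0 < α →
    (fun T : ℕ => (expectedPulls (A T) ν ν' k T).toReal) =o[atTop] fun T : ℕ => (T : ℝ) ^ α

/-- Consistency over all instances of the transfer setting. -/
def Setting.Consistent (S : Setting K) (A : Algorithm S.N') : Prop :=
  ∀ ν ν', S.IsInstance ν ν' → SubpolynomialPulls A ν ν'

/-- Consistency over all of `𝒟 ^ K × 𝒟' ^ K`, including the pairs that violate the constraint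
`d i (ν i) (ν' i) ≤ L i`. -/
def Setting.UnconstrainedConsistent (S : Setting K) (A : Algorithm S.N') : Prop :=
  ∀ ν ν', (∀ i, ν i ∈ S.𝒟) → (∀ i, ν' i ∈ S.𝒟') → SubpolynomialPulls A ν ν'

/-- `(ρ, ρ')` is an alternative for arm `k` and its source that has a mean above `m`. -/
def Setting.IsAlternative (S : Setting K) (k : Fin K) (m : ℝ) (ρ ρ' : ProbabilityMeasure ℝ) :
    Prop :=
  ρ ∈ S.𝒟 ∧ ρ' ∈ S.𝒟' ∧ m < mean ρ ∧ S.d k ρ ρ' ≤ S.L k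

/-- `𝒦_inf(σ; d_k, ρ, L_k)`: the least divergence from `σ` to a source law compatible with `ρ`. -/
noncomputable def Setting.Kinf (S : Setting K) (k : Fin K) (σ ρ : ProbabilityMeasure ℝ) : ℝ≥0∞ :=
  ⨅ (ρ' : ProbabilityMeasure ℝ) (_ : ρ' ∈ S.𝒟' ∧ S.d k ρ ρ' ≤ S.L k), KL σ ρ'

/-- The information about the alternative `(ρ, ρ')` at horizon `T`, divided by `ln T`. -/
noncomputable def Setting.ratio (S : Setting K) (A : Algorithm S.N')
    (ν ν' : Fin K → ProbabilityMeasure ℝ) (k : Fin K) (ρ ρ' : ProbabilityMeasure ℝ) (T : ℕ) :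
    ℝ≥0∞ :=
  (expectedPulls (A T) ν ν' k T * KL (ν k) ρ + (S.N' T k : ℝ≥0∞) * KL (ν' k) ρ') /
    ENNReal.ofReal (Real.log T)

/-- The infimum of the normalized information over all alternatives. -/
noncomputable def Setting.infRatio (S : Setting K) (A : Algorithm S.N')
    (ν ν' : Fin K → ProbabilityMeasure ℝ) (k : Fin K) (m : ℝ) (T : ℕ) : ℝ≥0∞ :=
  ⨅ (ρ : ProbabilityMeasure ℝ) (ρ' : ProbabilityMeasure ℝ) (_ : S.IsAlternative k m ρ ρ'),
    S.ratio A ν ν' k ρ ρ' T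

/-- The infimum over the alternative target law alone, with the offline term expressed by `Kinf`.
It runs over the target laws that are compatible with at least one source law. -/
noncomputable def Setting.infRatioKinf (S : Setting K) (A : Algorithm S.N')
    (ν ν' : Fin K → ProbabilityMeasure ℝ) (k : Fin K) (m : ℝ) (T : ℕ) : ℝ≥0∞ :=
  ⨅ (ρ : ProbabilityMeasure ℝ) (_ : ∃ ρ', S.IsAlternative k m ρ ρ'),
    (expectedPulls (A T) ν ν' k T * KL (ν k) ρ + (S.N' T k : ℝ≥0∞) * S.Kinf k (ν' k) ρ) /
      ENNReal.ofReal (Real.log T)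

/-- At most logarithmic source sample size for arm `k`, except for horizons at which it is
infinite. Every sample size that does not depend on the horizon has this property. -/
def Setting.LogOrInfinite (S : Setting K) (k : Fin K) : Prop :=
  ∃ C : ℝ≥0, ∀ᶠ T : ℕ in atTop,
    S.N' T k = ⊤ ∨ (S.N' T k : ℝ≥0∞) ≤ C * ENNReal.ofReal (Real.log T)

/-- The smallest divergence `KL (σ, ρ)` among the alternatives with source law exactly `σ'`
(infinite if there are none). -/
noncomputable def Setting.exactCost (S : Setting K) (k : Fin K) (m : ℝ)
    (σ σ' : ProbabilityMeasure ℝ) : ℝ≥0∞ :=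
  ⨅ (ρ : ProbabilityMeasure ℝ) (_ : S.IsAlternative k m ρ σ'), KL σ ρ

/-- Alternatives with a source law that is nearly `σ'` cost asymptotically at least as much as those
with source law exactly `σ'`: those of cost at most `c < exactCost` (all of them if
`exactCost = ∞`, through `c = ∞`) keep their source divergence away from zero. -/
def Setting.SourceRegular (S : Setting K) (k : Fin K) (m : ℝ)
    (σ σ' : ProbabilityMeasure ℝ) : Prop :=
  ∀ c : ℝ≥0∞, (c < S.exactCost k m σ σ' ∨ S.exactCost k m σ σ' = ⊤) →
    ∃ η : ℝ≥0∞, 0 < η ∧ ∀ ρ ρ', S.IsAlternative k m ρ ρ' → KL σ ρ ≤ c → η ≤ KL σ' ρ'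

end TransferBandit

/-!
The argument is a change of measure, followed by a compactness argument for the uniform version.

Change of measure. Replace arm `k` and its source by an alternative `(ρ, ρ')`. The chain rule for the
Kullback-Leibler divergence shows that the laws of everything observed up to the horizon are at
divergence at most `E[N_k(T)] * KL (ν k) ρ + N'_k * KL (ν' k) ρ'` (`klDiv_law_update_le`), because
the policy contributes nothing and all other arms are unchanged. In the modified problem arm `k` is
the unique best arm, so by consistency the fraction `Z` of rounds spent on other arms has mean of
order `o(T ^ (α - 1))`, whereas it has mean `1 - o(1)` in the original problem. The variational bound
`c * E_P[Z] ≤ klDiv P Q + (exp c - 1) * E_Q[Z]` (`mul_integral_le_klDiv`) with `exp c = T ^ (1 - α)`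
then gives `klDiv P Q ≥ (1 - o(1)) * (1 - α) * log T`, which is the bound for a fixed alternative
(`one_le_liminf_ratio`).

Uniformity. Consistency is not uniform over alternatives, but the normalized information is linear,
`x T * u + y T * v`, where `(x T, y T)` depends on the horizon only and `(u, v)` is the pair of
divergences of the alternative. If the infimum over alternatives stayed below some `b < 1` along a
sequence of horizons, then `x` and `y` would converge in `[0, ∞]` along an ultrafilter
(`one_le_liminf_iInf`). The limit of `x` is finite since `u` is bounded below. If the limit of `y` is
also finite, then the bounds for fixed alternatives pass to the limit and contradict the choice of
`b`. Otherwise nearly optimal alternatives have `v → 0`, and the regularity hypothesis (or `v = 0`, if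
the sample sizes are infinite) compares them to alternatives that keep the source law, for which the
bound for fixed alternatives applies. Under unconstrained consistency, every alternative target may
be combined with the unchanged source law, which reduces to the case `y = 0`.
-/

namespace TransferBandit

variable {K : ℕ}

/-! ### Kullback-Leibler divergence -/

section Divergence

variable {α β : Type*} {mα : MeasurableSpace α} {mβ : MeasurableSpace β}

/-- The conditional divergence is at most the mean divergence of the kernels. The integrand need not
be shown to be measurable, since `∫⁻` is a lower integral. -/
theorem klDiv_compProd_right_le [MeasurableSpace.CountableOrCountablyGenerated α β]
    (μ : Measure α) [IsFiniteMeasure μ] (κ η : Kernel α β) [IsMarkovKernel κ] [IsMarkovKernel η] :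
    klDiv (μ ⊗ₘ κ) (μ ⊗ₘ η) ≤ ∫⁻ a, klDiv (κ a) (η a) ∂μ := by
  by_cases hac : ∀ᵐ a ∂μ, κ a ≪ η a
  · have hκ : μ ⊗ₘ κ = (μ ⊗ₘ η).withDensity fun p => κ.rnDeriv η p.1 p.2 := by
      rw [← Measure.compProd_withDensity (κ.measurable_rnDeriv η)]
      refine Measure.compProd_congr ?_
      filter_upwards [hac] with a ha using (Kernel.withDensity_rnDeriv_eq ha).symm
    have hmeas : Measurable fun p : α × β => κ.rnDeriv η p.1 p.2 := κ.measurable_rnDeriv η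
    have hd : (μ ⊗ₘ κ).rnDeriv (μ ⊗ₘ η) =ᵐ[μ ⊗ₘ η] fun p => κ.rnDeriv η p.1 p.2 := by
      rw [hκ]
      exact Measure.rnDeriv_withDensity _ hmeas
    have hac' : μ ⊗ₘ κ ≪ μ ⊗ₘ η := by
      rw [hκ]
      exact withDensity_absolutelyContinuous _ _
    rw [klDiv_eq_lintegral_klFun_of_ac hac',
      lintegral_congr_ae (g := fun p => ENNReal.ofReal (klFun (κ.rnDeriv η p.1 p.2).toReal))
        (by filter_upwards [hd] with p hp using by rw [hp]),
      Measure.lintegral_compProd (by fun_prop)]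
    refine lintegral_mono_ae ?_
    filter_upwards [hac] with a ha
    rw [klDiv_eq_lintegral_klFun_of_ac ha]
    refine le_of_eq (lintegral_congr_ae ?_)
    filter_upwards [κ.rnDeriv_eq_rnDeriv_measure (η := η) (a := a)] with b hb using by rw [hb]
  · -- The divergence is infinite on the set without absolute continuity, which is not null.
    have hs : MeasurableSet {a | κ a ≪ η a}ᶜ := (Kernel.measurableSet_absolutelyContinuous κ η).compl
    have hpos : μ {a | κ a ≪ η a}ᶜ ≠ 0 := hac
    have : ∫⁻ a, klDiv (κ a) (η a) ∂μ = ⊤ := by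
      refine top_le_iff.1 ?_
      calc (⊤ : ℝ≥0∞) = ∫⁻ a, ({a | κ a ≪ η a}ᶜ).indicator (fun _ => ⊤) a ∂μ := by
            rw [lintegral_indicator_const hs, ENNReal.top_mul hpos]
        _ ≤ _ := by
            refine lintegral_mono fun a => ?_
            by_cases ha : κ a ≪ η a
            · simp [ha]
            · simp [klDiv_of_not_ac ha]
    rw [this]
    exact le_top

theorem klDiv_prod_le (μ ν : Measure α) (μ' ν' : Measure β) [IsProbabilityMeasure μ]
    [IsProbabilityMeasure ν] [IsProbabilityMeasure μ'] [IsProbabilityMeasure ν'] :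
    klDiv (μ.prod μ') (ν.prod ν') ≤ klDiv μ ν + klDiv μ' ν' := by
  rw [← Measure.compProd_const, ← Measure.compProd_const, klDiv_compProd_eq_add]
  gcongr
  rw [Measure.compProd_const, Measure.compProd_const, ← Measure.prod_swap (μ := μ') (ν := μ),
    ← Measure.prod_swap (μ := ν') (ν := μ)]
  refine (klDiv_map_le _ _ measurable_swap).trans ?_
  rw [← Measure.compProd_const, ← Measure.compProd_const, klDiv_compProd_left]

theorem klDiv_pi_fin_le {n : ℕ} {X : Fin n → Type*} [∀ i, MeasurableSpace (X i)]
    (μ ν : ∀ i, Measure (X i)) [∀ i, IsProbabilityMeasure (μ i)] [∀ i, IsProbabilityMeasure (ν i)] :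
    klDiv (Measure.pi μ) (Measure.pi ν) ≤ ∑ i, klDiv (μ i) (ν i) := by
  induction n with
  | zero =>
    rw [Measure.pi_of_empty μ, Measure.pi_of_empty ν, klDiv_self]
    exact zero_le
  | succ n ih =>
    have h (ξ : ∀ i, Measure (X i)) [∀ i, IsProbabilityMeasure (ξ i)] :=
      (MeasurePreserving.symm _ (measurePreserving_piFinSuccAbove ξ 0)).map_eq
    rw [← h μ, ← h ν, Fin.sum_univ_succ]
    refine (klDiv_map_le _ _ (MeasurableEquiv.measurable _)).trans ((klDiv_prod_le _ _ _ _).trans ?_)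
    gcongr
    exact ih (fun j => μ (Fin.succAbove 0 j)) fun j => ν (Fin.succAbove 0 j)

theorem klDiv_pi_le {ι : Type*} [Fintype ι] {X : ι → Type*} [∀ i, MeasurableSpace (X i)]
    (μ ν : ∀ i, Measure (X i)) [∀ i, IsProbabilityMeasure (μ i)] [∀ i, IsProbabilityMeasure (ν i)] :
    klDiv (Measure.pi μ) (Measure.pi ν) ≤ ∑ i, klDiv (μ i) (ν i) := by
  let e := (Fintype.equivFin ι).symm
  rw [← Measure.pi_map_piCongrLeft e μ, ← Measure.pi_map_piCongrLeft e ν,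
    ← Equiv.sum_comp e fun i => klDiv (μ i) (ν i)]
  exact (klDiv_map_le _ _ (MeasurableEquiv.measurable _)).trans (klDiv_pi_fin_le _ _)

theorem mul_sub_exp_le_klFun (s : ℝ) {x : ℝ} (hx : 0 ≤ x) :
    s * x - (Real.exp s - 1) ≤ klFun x := by
  rcases hx.eq_or_lt with rfl | hx
  · simpa [klFun_zero] using (Real.exp_pos s).le
  · have h := mul_le_mul_of_nonneg_left (Real.add_one_le_exp (s - Real.log x)) hx.le
    rw [Real.exp_sub, Real.exp_log hx, mul_div_cancel₀ _ hx.ne'] at h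
    rw [klFun_apply]
    nlinarith

/-- A variational bound: for a test function `Z` with values in `[0, 1]`, convexity of `exp`
bounds `exp (c * Z) - 1` by `(exp c - 1) * Z`, so that only the means of `Z` appear. -/
theorem mul_integral_le_klDiv (P Q : Measure α) [IsProbabilityMeasure P] [IsProbabilityMeasure Q]
    (hPQ : klDiv P Q ≠ ⊤) {Z : α → ℝ} (hZ : Measurable Z) (hZ0 : ∀ a, 0 ≤ Z a)
    (hZ1 : ∀ a, Z a ≤ 1) (c : ℝ) :
    c * ∫ a, Z a ∂P ≤ (klDiv P Q).toReal + (Real.exp c - 1) * ∫ a, Z a ∂Q := by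
  obtain ⟨hac, hint⟩ := klDiv_ne_top_iff.1 hPQ
  have hbdd : ∀ a, ‖Z a‖ ≤ 1 := fun a => by
    rw [Real.norm_of_nonneg (hZ0 a)]; exact hZ1 a
  have hiQ : Integrable Z Q := Integrable.of_bound hZ.aestronglyMeasurable 1 (ae_of_all _ hbdd)
  have hiP : Integrable Z P := Integrable.of_bound hZ.aestronglyMeasurable 1 (ae_of_all _ hbdd)
  have hiD : Integrable (fun a => (P.rnDeriv Q a).toReal * Z a) Q :=
    (integrable_rnDeriv_smul_iff hac).2 hiP
  have hD : ∫ a, (P.rnDeriv Q a).toReal * Z a ∂Q = ∫ a, Z a ∂P := integral_rnDeriv_smul hac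
  rw [toReal_klDiv_eq_integral_klFun hac, ← hD, ← integral_const_mul, ← integral_const_mul,
    ← integral_add ((integrable_klFun_rnDeriv_iff hac).2 hint) (hiQ.const_mul _)]
  refine integral_mono (hiD.const_mul c)
    (((integrable_klFun_rnDeriv_iff hac).2 hint).add (hiQ.const_mul _)) fun a => ?_
  have h := mul_sub_exp_le_klFun (c * Z a) (ENNReal.toReal_nonneg (a := P.rnDeriv Q a))
  have hconv := convexOn_exp.2 (Set.mem_univ 0) (Set.mem_univ c) (sub_nonneg.2 (hZ1 a)) (hZ0 a)
    (by ring)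
  simp only [smul_eq_mul, mul_zero, zero_add, Real.exp_zero, mul_one, mul_comm (Z a)] at hconv
  dsimp only
  nlinarith

end Divergence

/-! ### Divergence decomposition for bandits with offline data -/

section Decomposition

variable {n : Fin K → ℕ∞} (π : Policy n) (ν ν' : Fin K → ProbabilityMeasure ℝ)

theorem isProbabilityMeasure_offlineLaw (n : Fin K → ℕ∞) (ν' : Fin K → ProbabilityMeasure ℝ) :
    IsProbabilityMeasure (offlineLaw n ν') := by
  unfold offlineLaw
  infer_instance

theorem law_succ (t : ℕ) :
    law π ν ν' (t + 1) =
      ((law π ν ν' t) ⊗ₘ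
        ((π.select t) ⊗ₖ
          (Kernel.prodMkLeft (OfflineData n × History K t) (rewardKernel ν)))).map
        fun p => (p.1.1, Fin.snoc (α := fun _ => Fin K × ℝ) p.1.2 p.2) := rfl

/-- Joint law of the offline data, the first `t` rounds, and the arm pulled in the next round. -/
noncomputable def nextArmLaw (t : ℕ) : Measure ((OfflineData n × History K t) × Fin K) :=
  law π ν ν' t ⊗ₘ π.select t

instance isProbabilityMeasure_nextArmLaw (t : ℕ) :
    IsProbabilityMeasure (nextArmLaw π ν ν' t) := by
  have := π.isMarkov t
  have := isProbabilityMeasure_law π ν ν' t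
  unfold nextArmLaw
  infer_instance

theorem measurable_pullCount (k : Fin K) (t : ℕ) :
    Measurable fun h : OfflineData n × History K t =>
      ((Finset.univ.filter fun s : Fin t => (h.2 s).1 = k).card : ℝ≥0∞) := by
  simp only [Finset.card_filter, Nat.cast_sum, Nat.cast_ite, Nat.cast_one, Nat.cast_zero]
  refine Finset.measurable_sum _ fun s _ => Measurable.ite ?_ measurable_const measurable_const
  exact (measurableSet_singleton k).preimage (by fun_prop)

theorem expectedPulls_succ (k : Fin K) (t : ℕ) :
    expectedPulls π ν ν' k (t + 1) =
      expectedPulls π ν ν' k t + nextArmLaw π ν ν' t {p | p.2 = k} := by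
  have := π.isMarkov t
  have hk : MeasurableSet {p : (OfflineData n × History K t) × Fin K | p.2 = k} :=
    (measurableSet_singleton k).preimage measurable_snd
  let g : (OfflineData n × History K t) × Fin K → ℝ≥0∞ := fun p =>
    ((Finset.univ.filter fun s : Fin t => (p.1.2 s).1 = k).card : ℝ≥0∞)
      + {p : (OfflineData n × History K t) × Fin K | p.2 = k}.indicator 1 p
  have hg : Measurable g := ((measurable_pullCount k t).comp measurable_fst).add
    (measurable_one.indicator hk)
  have h1 : expectedPulls π ν ν' k (t + 1) =
      ∫⁻ p, g p.1 ∂((nextArmLaw π ν ν' t) ⊗ₘ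
        (Kernel.prodMkLeft (OfflineData n × History K t) (rewardKernel ν))) := by
    rw [expectedPulls, law_succ, lintegral_map (measurable_pullCount k (t + 1))
      (measurable_append n t), nextArmLaw, ← Measure.compProd_assoc,
      lintegral_map (by fun_prop) (MeasurableEquiv.measurable _)]
    refine lintegral_congr fun p => ?_
    simp only [g, Finset.card_filter, Fin.sum_univ_castSucc, Fin.snoc_castSucc, Fin.snoc_last]
    by_cases h : p.2.1 = k <;> simp [h, MeasurableEquiv.prodAssoc]
  have hcount : ∫⁻ p, ((Finset.univ.filter fun s : Fin t => (p.1.2 s).1 = k).card : ℝ≥0∞)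
      ∂(nextArmLaw π ν ν' t) = expectedPulls π ν ν' k t := by
    have := isProbabilityMeasure_law π ν ν' t
    have hm : Measurable fun p : (OfflineData n × History K t) × Fin K =>
        ((Finset.univ.filter fun s : Fin t => (p.1.2 s).1 = k).card : ℝ≥0∞) :=
      (measurable_pullCount k t).comp measurable_fst
    rw [nextArmLaw, Measure.lintegral_compProd hm]
    simp [expectedPulls]
  rw [h1, Measure.lintegral_compProd (by fun_prop)]
  simp only [lintegral_const, measure_univ, mul_one]
  rw [lintegral_add_right _ (measurable_one.indicator hk), lintegral_indicator_one hk, hcount]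

theorem sum_expectedPulls (t : ℕ) : ∑ i, expectedPulls π ν ν' i t = t := by
  have := isProbabilityMeasure_law π ν ν' t
  simp only [expectedPulls]
  rw [← lintegral_finsetSum _ fun i _ => measurable_pullCount i t]
  have h (h : OfflineData n × History K t) :
      ∑ i, ((Finset.univ.filter fun s : Fin t => (h.2 s).1 = i).card : ℝ≥0∞) = t := by
    rw [← Nat.cast_sum, Finset.sum_card_fiberwise_eq_card_filter]
    simp
  simp [h]

theorem expectedPulls_le (k : Fin K) (t : ℕ) : expectedPulls π ν ν' k t ≤ t :=
  (Finset.single_le_sum (f := fun i => expectedPulls π ν ν' i t) (fun _ _ => zero_le)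
    (Finset.mem_univ k)).trans (sum_expectedPulls π ν ν' t).le

variable (μ μ' : Fin K → ProbabilityMeasure ℝ)

/-- The arm of a round is chosen by the same kernel under both bandits, so it contributes no
divergence; only the reward does. -/
theorem klDiv_law_succ_le (t : ℕ) :
    klDiv (law π ν ν' (t + 1)) (law π μ μ' (t + 1)) ≤
      klDiv (law π ν ν' t) (law π μ μ' t) +
        ∑ i, nextArmLaw π ν ν' t {p | p.2 = i} * KL (ν i) (μ i) := by
  have := π.isMarkov t
  have := isProbabilityMeasure_law π ν ν' t
  have := isProbabilityMeasure_law π μ μ' t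
  rw [law_succ, law_succ]
  refine (klDiv_map_le _ _ (measurable_append n t)).trans ?_
  rw [klDiv_compProd_eq_add]
  gcongr
  rw [← Measure.compProd_assoc', ← Measure.compProd_assoc']
  refine (klDiv_map_le _ _ (MeasurableEquiv.measurable _)).trans
    ((klDiv_compProd_right_le _ _ _).trans ?_)
  have hf : Measurable fun i : Fin K => KL (ν i) (μ i) := measurable_of_countable _
  calc _ = ∫⁻ p, KL (ν p.2) (μ p.2) ∂(nextArmLaw π ν ν' t) := rfl
    _ = ∫⁻ i, KL (ν i) (μ i) ∂((nextArmLaw π ν ν' t).map Prod.snd) :=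
        (lintegral_map hf measurable_snd).symm
    _ ≤ _ := by
        rw [lintegral_fintype]
        refine le_of_eq (Finset.sum_congr rfl fun i _ => ?_)
        rw [Measure.map_apply measurable_snd (measurableSet_singleton i), mul_comm]
        rfl

theorem klDiv_law_zero_le :
    klDiv (law π ν ν' 0) (law π μ μ' 0) ≤ klDiv (offlineLaw n ν') (offlineLaw n μ') := by
  have := isProbabilityMeasure_offlineLaw n ν'
  have := isProbabilityMeasure_offlineLaw n μ'
  exact klDiv_map_le _ _ (by fun_prop)

/-- For infinitely many samples of an arm, the bound for this arm is `0` if the two laws agree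
and `∞` otherwise, so that only finite products need tensorization. -/
theorem klDiv_offlineLaw_le :
    klDiv (offlineLaw n ν') (offlineLaw n μ') ≤ ∑ i, (n i : ℝ≥0∞) * KL (ν' i) (μ' i) := by
  refine (klDiv_pi_le _ _).trans (Finset.sum_le_sum fun i _ => ?_)
  rcases eq_or_ne (n i) ⊤ with hi | hi
  · rcases eq_or_ne (KL (ν' i) (μ' i)) 0 with h0 | h0
    · rw [klDiv_eq_zero_iff.1 h0, klDiv_self]
      exact zero_le
    · simp [hi, ENNReal.top_mul h0]
  · obtain ⟨m, hm⟩ := ENat.ne_top_iff_exists.1 hi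
    have e : {j : ℕ // (j : ℕ∞) < n i} ≃ Fin m :=
      (Equiv.subtypeEquivRight fun j => by rw [← hm, Nat.cast_lt]).trans Fin.equivSubtype.symm
    have : Fintype {j : ℕ // (j : ℕ∞) < n i} := Fintype.ofEquiv _ e.symm
    rw [Measure.infinitePi_eq_pi, Measure.infinitePi_eq_pi]
    refine (klDiv_pi_le _ _).trans (le_of_eq ?_)
    rw [Finset.sum_const, Finset.card_univ, Fintype.card_congr e, Fintype.card_fin, ← hm]
    simp [KL]

/-- The divergence between the laws of everything that the learner observes. -/
theorem klDiv_law_le (t : ℕ) :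
    klDiv (law π ν ν' t) (law π μ μ' t) ≤
      ∑ i, (expectedPulls π ν ν' i t * KL (ν i) (μ i) + (n i : ℝ≥0∞) * KL (ν' i) (μ' i)) := by
  induction t with
  | zero =>
    refine ((klDiv_law_zero_le π ν ν' μ μ').trans (klDiv_offlineLaw_le ν' μ')).trans
      (Finset.sum_le_sum fun i _ => ?_)
    exact le_add_self
  | succ t ih =>
    refine (klDiv_law_succ_le π ν ν' μ μ' t).trans ((add_le_add_left ih _).trans (le_of_eq ?_))
    rw [← Finset.sum_add_distrib]
    refine Finset.sum_congr rfl fun i _ => ?_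
    rw [expectedPulls_succ, add_mul]
    ring

/-- When the two problems differ in arm `k` and its source only, the other arms contribute
nothing. -/
theorem klDiv_law_update_le (k : Fin K) (ρ ρ' : ProbabilityMeasure ℝ) (t : ℕ) :
    klDiv (law π ν ν' t) (law π (Function.update ν k ρ) (Function.update ν' k ρ') t) ≤
      expectedPulls π ν ν' k t * KL (ν k) ρ + (n k : ℝ≥0∞) * KL (ν' k) ρ' := by
  refine (klDiv_law_le _ _ _ _ _ t).trans (le_of_eq ?_)
  rw [Finset.sum_eq_single k]
  · simp
  · intro i _ hi
    simp [hi, KL]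
  · simp

end Decomposition

/-! ### The lower bound for a fixed alternative -/

section FixedAlternative

theorem expectedPulls_ne_top {n : Fin K → ℕ∞} (π : Policy n) (ν ν' : Fin K → ProbabilityMeasure ℝ)
    (k : Fin K) (t : ℕ) : expectedPulls π ν ν' k t ≠ ⊤ :=
  ne_top_of_le_ne_top (ENNReal.natCast_ne_top t) (expectedPulls_le π ν ν' k t)

/-- The fraction of the first `t` rounds in which arm `k` is not pulled. -/
noncomputable def otherFraction {n : Fin K → ℕ∞} (k : Fin K) (t : ℕ)
    (h : OfflineData n × History K t) : ℝ :=
  1 - ((Finset.univ.filter fun s : Fin t => (h.2 s).1 = k).card : ℝ) / t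

theorem integral_otherFraction {n : Fin K → ℕ∞} (π : Policy n)
    (ν ν' : Fin K → ProbabilityMeasure ℝ) (k : Fin K) (t : ℕ) :
    ∫ h, otherFraction k t h ∂(law π ν ν' t) = 1 - (expectedPulls π ν ν' k t).toReal / t := by
  have := isProbabilityMeasure_law π ν ν' t
  have hm := measurable_pullCount (n := n) k t
  have hint : Integrable (fun h : OfflineData n × History K t =>
      ((Finset.univ.filter fun s : Fin t => (h.2 s).1 = k).card : ℝ)) (law π ν ν' t) := by
    simpa using integrable_toReal_of_lintegral_ne_top hm.aemeasurable
      (expectedPulls_ne_top π ν ν' k t)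
  have hval : ∫ h, ((Finset.univ.filter fun s : Fin t => (h.2 s).1 = k).card : ℝ)
      ∂(law π ν ν' t) = (expectedPulls π ν ν' k t).toReal := by
    simpa [expectedPulls] using integral_toReal (μ := law π ν ν' t) hm.aemeasurable
      (ae_of_all _ fun h => ENNReal.natCast_lt_top _)
  simp only [otherFraction]
  rw [integral_sub (integrable_const _) (hint.div_const _), integral_div, hval]
  simp

theorem measurable_otherFraction {n : Fin K → ℕ∞} (k : Fin K) (t : ℕ) :
    Measurable (otherFraction (n := n) k t) := by
  have := (measurable_pullCount (n := n) k t).ennreal_toReal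
  simp only [ENNReal.toReal_natCast] at this
  exact (this.div_const _).const_sub 1

theorem otherFraction_nonneg {n : Fin K → ℕ∞} (k : Fin K) (t : ℕ)
    (h : OfflineData n × History K t) : 0 ≤ otherFraction k t h := by
  have hc : (Finset.univ.filter fun s : Fin t => (h.2 s).1 = k).card ≤ t := by
    simpa using Finset.card_filter_le (Finset.univ : Finset (Fin t)) fun s => (h.2 s).1 = k
  exact sub_nonneg.2 (div_le_one_of_le₀ (by exact_mod_cast hc) (Nat.cast_nonneg t))

theorem otherFraction_le_one {n : Fin K → ℕ∞} (k : Fin K) (t : ℕ)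
    (h : OfflineData n × History K t) : otherFraction k t h ≤ 1 :=
  sub_le_self _ (by positivity)

/-- A finite-horizon bound: under `(μ, μ')` the other arms must be pulled often, unless
they are pulled rarely under `(ν, ν')` or the two laws are far apart. -/
theorem mul_one_sub_le_klDiv_law {n : Fin K → ℕ∞} (π : Policy n)
    (ν ν' μ μ' : Fin K → ProbabilityMeasure ℝ) (k : Fin K) {t : ℕ} (ht : t ≠ 0)
    (hfin : klDiv (law π ν ν' t) (law π μ μ' t) ≠ ⊤) (c : ℝ) :
    c * (1 - (expectedPulls π ν ν' k t).toReal / t) ≤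
      (klDiv (law π ν ν' t) (law π μ μ' t)).toReal +
        (Real.exp c - 1) *
          ((∑ j ∈ Finset.univ.erase k, (expectedPulls π μ μ' j t).toReal) / t) := by
  have := isProbabilityMeasure_law π ν ν' t
  have := isProbabilityMeasure_law π μ μ' t
  have h := mul_integral_le_klDiv _ _ hfin (measurable_otherFraction k t) (otherFraction_nonneg k t)
    (otherFraction_le_one k t) c
  have ht' : (t : ℝ) ≠ 0 := Nat.cast_ne_zero.2 ht
  have hsum : ∑ j, (expectedPulls π μ μ' j t).toReal = t := by
    rw [← ENNReal.toReal_sum fun j _ => expectedPulls_ne_top π μ μ' j t, sum_expectedPulls]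
    simp
  rw [← Finset.add_sum_erase _ _ (Finset.mem_univ k)] at hsum
  rw [integral_otherFraction, integral_otherFraction] at h
  convert h using 4
  rw [eq_sub_iff_add_eq, ← add_div, add_comm, hsum, div_self ht']

/-- The change-of-measure argument: arm `k` is rarely pulled under `(ν, ν')`, but it is the best arm
of the modified problem, where the other arms are rarely pulled. -/
theorem one_le_liminf_ratio (S : Setting K) (A : Algorithm S.N') (ν ν' : Fin K → ProbabilityMeasure ℝ)
    (k : Fin K) (ρ ρ' : ProbabilityMeasure ℝ) (hk : Suboptimal ν k)
    (hρ : ∀ j, j ≠ k → mean (ν j) < mean ρ) (hν : SubpolynomialPulls A ν ν')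
    (hν' : SubpolynomialPulls A (Function.update ν k ρ) (Function.update ν' k ρ')) :
    1 ≤ liminf (fun T : ℕ => S.ratio A ν ν' k ρ ρ' T) atTop := by
  refine le_of_forall_lt_imp_le_of_dense fun b hb => le_liminf_of_le (by isBoundedDefault) ?_
  lift b to ℝ≥0 using hb.ne_top
  have hb1 : (b : ℝ) < 1 := by exact_mod_cast hb
  have hb0 : (0 : ℝ) ≤ b := b.2
  -- With `α = (1 - b) / 2` and `c = (1 - α) * log T`, the leading term `(1 - α) * log T` exceeds
  -- `b * log T` by a margin that absorbs the error terms.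
  set α : ℝ := (1 - b) / 2 with hα
  have hα0 : 0 < α := by rw [hα]; linarith
  have hx := (hν k hk 1 one_pos).bound (c := α / 2) (by positivity)
  have hy : (fun T : ℕ => ∑ j ∈ Finset.univ.erase k,
      (expectedPulls (A T) (Function.update ν k ρ) (Function.update ν' k ρ') j T).toReal) =o[atTop]
        fun T : ℕ => (T : ℝ) ^ α := by
    refine IsLittleO.fun_sum fun j hj => hν' j ⟨k, ?_⟩ α hα0
    have hjk := Finset.ne_of_mem_erase hj
    simpa [hjk] using hρ j hjk
  have hlog : ∀ᶠ T : ℕ in atTop, 2 / α ≤ Real.log T :=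
    (Real.tendsto_log_atTop.comp tendsto_natCast_atTop_atTop).eventually_ge_atTop _
  filter_upwards [hx, hy.bound (c := 1) one_pos, hlog, eventually_gt_atTop 0] with T hx hy hlog hT
  have hT0 : (0 : ℝ) < T := by exact_mod_cast hT
  have hlog0 : 0 < Real.log T := (by positivity : 0 < 2 / α).trans_le hlog
  rw [Setting.ratio, ENNReal.le_div_iff_mul_le (Or.inl (by simpa using hlog0))
    (Or.inl ENNReal.ofReal_ne_top)]
  refine le_trans ?_ (klDiv_law_update_le (A T) ν ν' k ρ ρ' T)
  by_cases hfin : klDiv (law (A T) ν ν' T)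
      (law (A T) (Function.update ν k ρ) (Function.update ν' k ρ') T) = ⊤
  · rw [hfin]
    exact le_top
  have key := mul_one_sub_le_klDiv_law (A T) ν ν' _ _ k hT.ne' hfin ((1 - α) * Real.log T)
  set x := (expectedPulls (A T) ν ν' k T).toReal
  set y := ∑ j ∈ Finset.univ.erase k,
      (expectedPulls (A T) (Function.update ν k ρ) (Function.update ν' k ρ') j T).toReal
  set D := klDiv (law (A T) ν ν' T)
      (law (A T) (Function.update ν k ρ) (Function.update ν' k ρ') T)
  have hx0 : 0 ≤ x := ENNReal.toReal_nonneg
  have hy0 : 0 ≤ y := Finset.sum_nonneg fun _ _ => ENNReal.toReal_nonneg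
  rw [Real.rpow_one, Real.norm_of_nonneg hx0, Real.norm_of_nonneg hT0.le] at hx
  rw [Real.norm_of_nonneg hy0, Real.norm_of_nonneg (by positivity), one_mul] at hy
  have hxT : x / T ≤ α / 2 := (div_le_iff₀ hT0).2 hx
  have hexp : Real.exp ((1 - α) * Real.log T) = T / (T : ℝ) ^ α := by
    rw [mul_comm, ← Real.rpow_def_of_pos hT0, Real.rpow_sub hT0, Real.rpow_one]
  have hyT : (Real.exp ((1 - α) * Real.log T) - 1) * (y / T) ≤ 1 := by
    have h1 : 0 ≤ y / T := by positivity
    have h2 : Real.exp ((1 - α) * Real.log T) * (y / T) = y / (T : ℝ) ^ α := by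
      rw [hexp]
      field_simp
    have h3 : y / (T : ℝ) ^ α ≤ 1 := div_le_one_of_le₀ hy (by positivity)
    linarith
  have h2α : 2 ≤ α * Real.log T := by
    rw [div_le_iff₀ hα0] at hlog
    linarith
  have hbα : (b : ℝ) = 1 - 2 * α := by rw [hα]; ring
  have hD : (b : ℝ) * Real.log T ≤ D.toReal := by
    have h4 : (1 - α) * Real.log T * (1 - α / 2) ≤ (1 - α) * Real.log T * (1 - x / T) := by
      have : 0 ≤ (1 - α) * Real.log T := mul_nonneg (by linarith) hlog0.le
      gcongr
    have h5 : 0 ≤ α ^ 2 * Real.log T := by positivity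
    rw [hbα]
    nlinarith
  rw [← ENNReal.ofReal_coe_nnreal, ← ENNReal.ofReal_mul hb0, ← ENNReal.ofReal_toReal hfin]
  exact ENNReal.ofReal_le_ofReal hD

end FixedAlternative

/-! ### Uniformity over the alternatives -/

section Uniformity

/-- Multiplication by a constant `u` is continuous along an ultrafilter, apart from the case
`0 * ∞`: if the limit of `x` is `0` but `x` is not eventually `0`, then `x T * ∞ = ∞`. -/
theorem eventually_tendsto_mul {U : Ultrafilter ℕ} {x : ℕ → ℝ≥0∞} {a : ℝ≥0∞}
    (hx : Tendsto x U (𝓝 a)) :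
    ∀ᶠ T in (U : Filter ℕ), ∀ u, x T * u ≠ ⊤ → Tendsto (fun s => x s * u) U (𝓝 (a * u)) := by
  by_cases ha : a = 0
  · rcases Ultrafilter.em U fun T => x T = 0 with h | h
    · refine Eventually.of_forall fun _ u _ => ?_
      rw [ha, zero_mul]
      refine tendsto_const_nhds.congr' ?_
      filter_upwards [h] with s hs using by rw [hs, zero_mul]
    · filter_upwards [h] with T hT u hu
      refine ENNReal.Tendsto.mul_const hx (Or.inr ?_)
      rintro rfl
      exact hu (ENNReal.mul_top hT)
  · exact Eventually.of_forall fun _ u _ => ENNReal.Tendsto.mul_const hx (Or.inl ha)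

/-- If every linear combination `x T * u i + y T * v i` is asymptotically at least `1`,
then so is their infimum over `i`. This needs a positive lower bound for `u`, and, along horizons
with `y T → ∞`, control of the `u i` with small `v i` by those with `v i = 0`. -/
theorem one_le_liminf_iInf {ι : Type*} {u v : ι → ℝ≥0∞} {x y : ℕ → ℝ≥0∞}
    (h : ∀ i, 1 ≤ liminf (fun T => x T * u i + y T * v i) atTop) (hu : 0 < ⨅ i, u i)
    (hreg : (∃ C : ℝ≥0, ∀ᶠ T in atTop, y T = ⊤ ∨ y T ≤ C) ∨
      ∀ c, (c < ⨅ (i) (_ : v i = 0), u i) ∨ (⨅ (i) (_ : v i = 0), u i) = ⊤ →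
        ∃ η > 0, ∀ i, u i ≤ c → η ≤ v i) :
    1 ≤ liminf (fun T => ⨅ i, x T * u i + y T * v i) atTop := by
  by_contra hlt
  obtain ⟨b, hb, hb1⟩ := exists_between (not_le.1 hlt)
  have hfreq : ∃ᶠ T in atTop, (⨅ i, x T * u i + y T * v i) < b :=
    frequently_lt_of_liminf_lt (by isBoundedDefault) hb
  have : NeBot (atTop ⊓ 𝓟 {T | (⨅ i, x T * u i + y T * v i) < b}) := frequently_iff_neBot.1 hfreq
  -- Along the ultrafilter `U`, the infimum stays below `b`, and both `x` and `y` have limits.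
  let U : Ultrafilter ℕ := Ultrafilter.of (atTop ⊓ 𝓟 {T | (⨅ i, x T * u i + y T * v i) < b})
  have hUtop : (U : Filter ℕ) ≤ atTop := (Ultrafilter.of_le _).trans inf_le_left
  have hUb : ∀ᶠ T in (U : Filter ℕ), (⨅ i, x T * u i + y T * v i) < b :=
    ((Ultrafilter.of_le _).trans inf_le_right) (mem_principal_self _)
  have hne : Nonempty ι := by
    by_contra hι
    rw [not_nonempty_iff] at hι
    obtain ⟨T, hT⟩ := hUb.exists
    rw [iInf_of_empty] at hT
    exact not_top_lt hT
  have hch : ∃ j : ℕ → ι, ∀ᶠ T in (U : Filter ℕ), x T * u (j T) + y T * v (j T) < b := by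
    choose! j hj using fun T (hT : (⨅ i, x T * u i + y T * v i) < b) => iInf_lt_iff.1 hT
    exact ⟨j, hUb.mono hj⟩
  obtain ⟨j, hj⟩ := hch
  have hjx : ∀ᶠ T in (U : Filter ℕ), x T * u (j T) < b := hj.mono fun T hT => le_self_add.trans_lt hT
  have hjy : ∀ᶠ T in (U : Filter ℕ), y T * v (j T) < b := hj.mono fun T hT => le_add_self.trans_lt hT
  have hlim (f : ℕ → ℝ≥0∞) : ∃ a, Tendsto f U (𝓝 a) := ⟨_, (U.map f).le_nhds_lim⟩
  obtain ⟨a, ha⟩ := hlim x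
  obtain ⟨d, hd⟩ := hlim y
  have hU (i : ι) {r : ℝ≥0∞} (hr : Tendsto (fun T => x T * u i + y T * v i) U (𝓝 r)) : 1 ≤ r := by
    refine le_of_forall_lt_imp_le_of_dense fun e he => ge_of_tendsto hr ?_
    exact ((eventually_lt_of_lt_liminf (he.trans_le (h i))).filter_mono hUtop).mono fun _ => le_of_lt
  have ha_top : a ≠ ⊤ := by
    refine ne_top_of_le_ne_top (ENNReal.div_ne_top hb1.ne_top hu.ne') (le_of_tendsto ha ?_)
    filter_upwards [hjx] with T hT
    rw [ENNReal.le_div_iff_mul_le (Or.inl hu.ne') (Or.inr hb1.ne_top)]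
    exact (mul_le_mul_right (iInf_le u (j T)) _).trans hT.le
  by_cases hd_top : d = ⊤
  · -- The source samples force `v (j T) → 0`, so only alternatives with `v i = 0` matter.
    have hcost : (⨅ (i) (_ : v i = 0), u i) ≠ ⊤ ∧
        ∀ c, (c < ⨅ (i) (_ : v i = 0), u i) → ∀ᶠ T in (U : Filter ℕ), c < u (j T) := by
      rcases hreg with ⟨C, hC⟩ | hreg
      · have hy_top : ∀ᶠ T in (U : Filter ℕ), y T = ⊤ := by
          have h1 : ∀ᶠ T in (U : Filter ℕ), (C : ℝ≥0∞) < y T :=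
            hd.eventually_const_lt (by simp [hd_top])
          filter_upwards [h1, hC.filter_mono hUtop] with T h1 h2
            using h2.resolve_right h1.not_ge
        have hv : ∀ᶠ T in (U : Filter ℕ), v (j T) = 0 := by
          filter_upwards [hy_top, hjy] with T h1 h2
          by_contra h0
          rw [h1, ENNReal.top_mul h0] at h2
          exact not_top_lt h2
        refine ⟨fun htop => ?_, fun c hc => hv.mono fun T hT => hc.trans_le (iInf₂_le (j T) hT)⟩
        -- An alternative with `v i = 0` and `u i = ∞` forces `x` to be nonzero.
        have hu_top : ∀ᶠ T in (U : Filter ℕ), u (j T) = ⊤ :=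
          hv.mono fun T hT => top_le_iff.1 (htop ▸ iInf₂_le (j T) hT)
        have hx0 : ∀ᶠ T in (U : Filter ℕ), x T = 0 := by
          filter_upwards [hu_top, hjx] with T h1 h2
          by_contra h0
          rw [h1, ENNReal.mul_top h0] at h2
          exact not_top_lt h2
        obtain ⟨T, hT⟩ := hv.exists
        have := hU (j T) (r := 0) (tendsto_const_nhds.congr' (by
          filter_upwards [hx0] with s hs using by simp [hs, hT]))
        simp at this
      · have hv (η : ℝ≥0∞) (hη : 0 < η) : ∀ᶠ T in (U : Filter ℕ), v (j T) < η := by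
          have h1 : ∀ᶠ T in (U : Filter ℕ), b / η < y T :=
            hd.eventually_const_lt (by
              rw [hd_top]; exact ENNReal.div_lt_top hb1.ne_top hη.ne')
          filter_upwards [h1, hjy] with T h1 h2
          by_contra! h3
          refine absurd h1 (not_lt.2 ?_)
          rw [ENNReal.le_div_iff_mul_le (Or.inl hη.ne') (Or.inr hb1.ne_top)]
          exact (mul_le_mul_right h3 _).trans h2.le
        refine ⟨fun htop => ?_, fun c hc => ?_⟩
        · obtain ⟨η, hη, hηv⟩ := hreg ⊤ (Or.inr htop)
          obtain ⟨T, hT⟩ := (hv η hη).exists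
          exact (hηv _ le_top).not_gt hT
        · obtain ⟨η, hη, hηv⟩ := hreg c (Or.inl hc)
          filter_upwards [hv η hη] with T hT
          by_contra! h3
          exact (hηv _ h3).not_gt hT
    obtain ⟨hcost_top, hcost⟩ := hcost
    have hinv : a⁻¹ ≤ ⨅ (i) (_ : v i = 0), u i := by
      refine le_iInf₂ fun i hi => ?_
      by_cases hui : u i = ⊤
      · simp [hui]
      · rw [ENNReal.inv_le_iff_le_mul (fun h => absurd h hui) (fun h => absurd h ha_top)]
        refine hU i ?_
        simpa [hi] using ENNReal.Tendsto.mul_const ha (Or.inr hui)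
    have ha0 : a ≠ 0 := by
      rintro rfl
      rw [ENNReal.inv_zero, top_le_iff] at hinv
      exact hcost_top hinv
    obtain ⟨b', hbb', hb'1⟩ := exists_between hb1
    have hlt : b' * a⁻¹ < ⨅ (i) (_ : v i = 0), u i := by
      refine lt_of_lt_of_le ?_ hinv
      have := ENNReal.mul_lt_mul_left (ENNReal.inv_ne_zero.2 ha_top) (ENNReal.inv_ne_top.2 ha0) hb'1
      simpa using this
    have hle : a * (b' * a⁻¹) ≤ b := by
      refine le_of_tendsto (ENNReal.Tendsto.mul_const ha (Or.inl ha0)) ?_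
      filter_upwards [hcost _ hlt, hjx] with T h1 h2
      exact (mul_le_mul_right h1.le _).trans h2.le
    rw [mul_left_comm, ENNReal.mul_inv_cancel ha0 ha_top, mul_one] at hle
    exact hle.not_gt hbb'
  · obtain ⟨r, hbr, hr1⟩ := exists_between hb1
    have hscale {z : ℕ → ℝ≥0∞} {e : ℝ≥0∞} (hz : Tendsto z U (𝓝 e)) (he : e ≠ ⊤) :
        ∀ᶠ T in (U : Filter ℕ), r * e ≤ z T := by
      by_cases he0 : e = 0
      · simp [he0]
      · refine (hz.eventually_const_lt ?_).mono fun _ => le_of_lt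
        simpa using ENNReal.mul_lt_mul_left he0 he hr1
    obtain ⟨T, hT, hTx, hTy, hxT, hyT⟩ := (hj.and ((eventually_tendsto_mul ha).and
      ((eventually_tendsto_mul hd).and ((hscale ha ha_top).and (hscale hd hd_top))))).exists
    have hone := hU (j T) ((hTx _ (ne_top_of_lt (le_self_add.trans_lt hT))).add
      (hTy _ (ne_top_of_lt (le_add_self.trans_lt hT))))
    refine absurd hbr (not_lt.2 ?_)
    calc r ≤ r * (a * u (j T) + d * v (j T)) := le_mul_of_one_le_right' hone
      _ = r * a * u (j T) + r * d * v (j T) := by ring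
      _ ≤ x T * u (j T) + y T * v (j T) := by gcongr
      _ ≤ b := hT.le

end Uniformity

/-! ### The infimum over all alternatives -/

section Infimum

theorem KL_eq_zero_iff {ρ σ : ProbabilityMeasure ℝ} : KL ρ σ = 0 ↔ ρ = σ :=
  klDiv_eq_zero_iff.trans Subtype.coe_injective.eq_iff

variable (S : Setting K) (A : Algorithm S.N') (ν ν' : Fin K → ProbabilityMeasure ℝ) (k : Fin K)
  (m : ℝ)

theorem ratio_eq (ρ ρ' : ProbabilityMeasure ℝ) (T : ℕ) :
    S.ratio A ν ν' k ρ ρ' T =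
      expectedPulls (A T) ν ν' k T / ENNReal.ofReal (Real.log T) * KL (ν k) ρ +
        (S.N' T k : ℝ≥0∞) / ENNReal.ofReal (Real.log T) * KL (ν' k) ρ' := by
  simp only [Setting.ratio, div_eq_mul_inv]
  ring

theorem infRatio_eq (T : ℕ) :
    S.infRatio A ν ν' k m T =
      ⨅ p : {p : ProbabilityMeasure ℝ × ProbabilityMeasure ℝ // S.IsAlternative k m p.1 p.2},
        S.ratio A ν ν' k p.1.1 p.1.2 T := by
  rw [iInf_subtype, iInf_prod]
  rfl

theorem exactCost_eq (σ σ' : ProbabilityMeasure ℝ) :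
    S.exactCost k m σ σ' =
      ⨅ (p : {p : ProbabilityMeasure ℝ × ProbabilityMeasure ℝ // S.IsAlternative k m p.1 p.2})
        (_ : KL σ' p.1.2 = 0), KL σ p.1.1 := by
  refine le_antisymm (le_iInf₂ fun p hp => ?_) (le_iInf₂ fun ρ hρ => ?_)
  · exact iInf₂_le p.1.1 (KL_eq_zero_iff.1 hp ▸ p.2)
  · exact iInf₂_le_of_le ⟨(ρ, σ'), hρ⟩ (klDiv_self _) le_rfl

variable {S A ν ν' k m}

theorem one_le_liminf_infRatio
    (hfix : ∀ ρ ρ', S.IsAlternative k m ρ ρ' →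
      1 ≤ liminf (fun T : ℕ => S.ratio A ν ν' k ρ ρ' T) atTop)
    (hpos : 0 < ⨅ (ρ : ProbabilityMeasure ℝ) (ρ' : ProbabilityMeasure ℝ)
      (_ : S.IsAlternative k m ρ ρ'), KL (ν k) ρ)
    (h : S.LogOrInfinite k ∨ S.SourceRegular k m (ν k) (ν' k)) :
    1 ≤ liminf (fun T : ℕ => S.infRatio A ν ν' k m T) atTop := by
  simp only [infRatio_eq, ratio_eq] at hfix ⊢
  refine one_le_liminf_iInf (fun p => hfix _ _ p.2) ?_ ?_
  · rwa [iInf_subtype, iInf_prod]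
  · refine h.imp ?_ fun hreg c hc => ?_
    · rintro ⟨C, hC⟩
      refine ⟨C, ?_⟩
      filter_upwards [hC] with T hT
      refine hT.imp (fun h => ?_) fun h => ?_
      · rw [h, ENat.toENNReal_top, ENNReal.top_div_of_ne_top ENNReal.ofReal_ne_top]
      · exact ENNReal.div_le_of_le_mul h
    · rw [← exactCost_eq] at hc
      obtain ⟨η, hη, hηv⟩ := hreg c hc
      exact ⟨η, hη, fun p hp => hηv _ _ p.2 hp⟩

/-- If the alternatives may keep the source law unchanged, then the online term alone
satisfies the bound. -/
theorem one_le_liminf_infRatio_of_unchanged_source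
    (hfix : ∀ ρ ρ', S.IsAlternative k m ρ ρ' →
      1 ≤ liminf (fun T : ℕ => S.ratio A ν ν' k ρ (ν' k) T) atTop)
    (hpos : 0 < ⨅ (ρ : ProbabilityMeasure ℝ) (ρ' : ProbabilityMeasure ℝ)
      (_ : S.IsAlternative k m ρ ρ'), KL (ν k) ρ) :
    1 ≤ liminf (fun T : ℕ => S.infRatio A ν ν' k m T) atTop := by
  have h0 : KL (ν' k) (ν' k) = 0 := klDiv_self _
  simp only [ratio_eq, h0, mul_zero, add_zero] at hfix
  have h := one_le_liminf_iInf (y := fun _ => 0) (v := fun _ => 0)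
    (ι := {p : ProbabilityMeasure ℝ × ProbabilityMeasure ℝ // S.IsAlternative k m p.1 p.2})
    (u := fun p => KL (ν k) p.1.1)
    (x := fun T => expectedPulls (A T) ν ν' k T / ENNReal.ofReal (Real.log T))
    (fun p => by simpa using hfix _ _ p.2) (by rwa [iInf_subtype, iInf_prod])
    (Or.inl ⟨0, by simp⟩)
  refine h.trans (liminf_le_liminf (Eventually.of_forall fun T => ?_))
  simp only [infRatio_eq, ratio_eq]
  refine iInf_mono fun p => ?_
  rw [zero_mul, add_zero]
  exact le_self_add

/-- The infimum over the source laws can be taken inside the offline term. For infinitely many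
source samples, this requires that a vanishing `Kinf` is attained. -/
theorem infRatioKinf_eq_infRatio (hν' : ν' k ∈ S.𝒟') {T : ℕ} (hT : 2 ≤ T)
    (h : S.N' T k ≠ ⊤ ∨ ∀ ρ ρ', S.IsAlternative k m ρ ρ' →
      S.Kinf k (ν' k) ρ = 0 → S.d k ρ (ν' k) ≤ S.L k) :
    S.infRatioKinf A ν ν' k m T = S.infRatio A ν ν' k m T := by
  have hlog : ENNReal.ofReal (Real.log T) ≠ 0 := by
    simpa using Real.log_pos (by exact_mod_cast hT : (1 : ℝ) < T)
  refine le_antisymm (le_iInf fun ρ => le_iInf₂ fun ρ' hρ => ?_) (le_iInf₂ fun ρ hρ => ?_)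
  · refine iInf₂_le_of_le ρ ⟨ρ', hρ⟩ ?_
    simp only [Setting.ratio, Setting.Kinf]
    gcongr
    exact iInf₂_le ρ' ⟨hρ.2.1, hρ.2.2.2⟩
  · obtain ⟨ρ₀, hρ₀⟩ := hρ
    have halt (ρ' : ProbabilityMeasure ℝ) (h' : ρ' ∈ S.𝒟' ∧ S.d k ρ ρ' ≤ S.L k) :
        S.IsAlternative k m ρ ρ' := ⟨hρ₀.1, h'.1, hρ₀.2.2.1, h'.2⟩
    have hle (ρ' : ProbabilityMeasure ℝ) (h' : ρ' ∈ S.𝒟' ∧ S.d k ρ ρ' ≤ S.L k) :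
        S.infRatio A ν ν' k m T ≤ S.ratio A ν ν' k ρ ρ' T :=
      (iInf_le _ ρ).trans (iInf₂_le ρ' (halt ρ' h'))
    by_cases hK : S.N' T k = ⊤ ∧ S.Kinf k (ν' k) ρ = 0
    · refine (hle (ν' k) ⟨hν', h.resolve_left (not_not.2 hK.1) ρ ρ₀ hρ₀ hK.2⟩).trans ?_
      simp [Setting.ratio, KL, hK.2]
    · have hmul : (S.N' T k : ℝ≥0∞) * S.Kinf k (ν' k) ρ =
          ⨅ p : {ρ' : ProbabilityMeasure ℝ // ρ' ∈ S.𝒟' ∧ S.d k ρ ρ' ≤ S.L k},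
            (S.N' T k : ℝ≥0∞) * KL (ν' k) p := by
        have : Nonempty {ρ' : ProbabilityMeasure ℝ // ρ' ∈ S.𝒟' ∧ S.d k ρ ρ' ≤ S.L k} :=
          ⟨⟨ρ₀, hρ₀.2.1, hρ₀.2.2.2⟩⟩
        rw [Setting.Kinf, iInf_subtype', ENNReal.mul_iInf' (fun htop h0 => ?_) fun _ => this]
        rw [iInf_subtype] at h0
        exact absurd ⟨ENat.toENNReal_eq_top.1 htop, h0⟩ hK
      rw [hmul, ENNReal.add_iInf, ENNReal.iInf_div' (fun h0 => absurd h0 hlog)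
        fun htop => absurd htop ENNReal.ofReal_ne_top]
      exact le_iInf fun p => hle p p.2

end Infimum

end TransferBandit

theorem theorem1 {K : ℕ} (S : TransferBandit.Setting K)
    (hmean : ∀ ρ ∈ S.𝒟, Integrable (fun x : ℝ => x) (ρ : Measure ℝ))
    (A : TransferBandit.Algorithm S.N') (hA : S.Consistent A)
    (ν ν' : Fin K → ProbabilityMeasure ℝ) (hν : S.IsInstance ν ν')
    (one : Fin K) (hone : ∀ i, TransferBandit.mean (ν i) ≤ TransferBandit.mean (ν one))
    (k : Fin K) (hk : TransferBandit.Suboptimal ν k) :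
    (∀ ρ ρ', S.IsAlternative k (TransferBandit.mean (ν one)) ρ ρ' →
      1 ≤ liminf (fun T : ℕ => S.ratio A ν ν' k ρ ρ' T) atTop) ∧
    ((0 < ⨅ (ρ : ProbabilityMeasure ℝ) (ρ' : ProbabilityMeasure ℝ)
          (_ : S.IsAlternative k (TransferBandit.mean (ν one)) ρ ρ'),
            TransferBandit.KL (ν k) ρ) →
      (S.LogOrInfinite k ∨ S.UnconstrainedConsistent A ∨
        S.SourceRegular k (TransferBandit.mean (ν one)) (ν k) (ν' k)) →
      1 ≤ liminf (fun T : ℕ => S.infRatio A ν ν' k (TransferBandit.mean (ν one)) T) atTop ∧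
      (((∀ T, S.N' T k ≠ ⊤) ∨
          ∀ ρ ρ', S.IsAlternative k (TransferBandit.mean (ν one)) ρ ρ' →
            S.Kinf k (ν' k) ρ = 0 → S.d k ρ (ν' k) ≤ S.L k) →
        (∀ T : ℕ, 2 ≤ T →
          S.infRatioKinf A ν ν' k (TransferBandit.mean (ν one)) T =
            S.infRatio A ν ν' k (TransferBandit.mean (ν one)) T) ∧
        1 ≤ liminf (fun T : ℕ =>
          S.infRatioKinf A ν ν' k (TransferBandit.mean (ν one)) T) atTop)) := by
  have hbest (ρ ρ') (h : S.IsAlternative k (TransferBandit.mean (ν one)) ρ ρ') :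
      ∀ j, j ≠ k → TransferBandit.mean (ν j) < TransferBandit.mean ρ :=
    fun j _ => (hone j).trans_lt h.2.2.1
  have hfix : ∀ ρ ρ', S.IsAlternative k (TransferBandit.mean (ν one)) ρ ρ' →
      1 ≤ liminf (fun T : ℕ => S.ratio A ν ν' k ρ ρ' T) atTop := fun ρ ρ' h => by
    refine TransferBandit.one_le_liminf_ratio S A ν ν' k ρ ρ' hk (hbest ρ ρ' h) (hA ν ν' hν)
      (hA _ _ ⟨fun i => ?_, fun i => ?_, fun i => ?_⟩)
    all_goals rcases eq_or_ne i k with rfl | hi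
    · simpa using h.1
    · simpa [hi] using hν.1 i
    · simpa using h.2.1
    · simpa [hi] using hν.2.1 i
    · simpa using h.2.2.2
    · simpa [hi] using hν.2.2 i
  refine ⟨hfix, fun hpos hcases => ?_⟩
  have hinf : 1 ≤ liminf
      (fun T : ℕ => S.infRatio A ν ν' k (TransferBandit.mean (ν one)) T) atTop := by
    rcases hcases with hlog | hunc | hreg
    · exact TransferBandit.one_le_liminf_infRatio hfix hpos (Or.inl hlog)
    · refine TransferBandit.one_le_liminf_infRatio_of_unchanged_source (fun ρ ρ' h => ?_) hpos
      refine TransferBandit.one_le_liminf_ratio S A ν ν' k ρ (ν' k) hk (hbest ρ ρ' h) (hA ν ν' hν)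
        (hunc _ _ (fun i => ?_) fun i => ?_)
      · rcases eq_or_ne i k with rfl | hi
        · simpa using h.1
        · simpa [hi] using hν.1 i
      · simpa using hν.2.1 i
    · exact TransferBandit.one_le_liminf_infRatio hfix hpos (Or.inr hreg)
  refine ⟨hinf, fun hatt => ?_⟩
  have heq : ∀ T : ℕ, 2 ≤ T →
      S.infRatioKinf A ν ν' k (TransferBandit.mean (ν one)) T =
        S.infRatio A ν ν' k (TransferBandit.mean (ν one)) T := fun T hT =>
    TransferBandit.infRatioKinf_eq_infRatio (hν.2.1 k) hT (hatt.imp_left fun h => h T)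
  refine ⟨heq, hinf.trans_eq (liminf_congr ?_)⟩
  filter_upwards [eventually_ge_atTop 2] with T hT using (heq T hT).symm
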